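/- Let $A$ be an arbitrary alphabet and let $u\in A^*$ be a word; $1$ denotes the empty word. For a word $w$, let $w^{(+)}$ be the palindromic closure of $w$, i.e. the unique shortest palindrome having $w$ as a prefix, and let $\mathrm{Pal}:A^*\to A^*$ be the iterated palindromic closure, defined by $\mathrm{Pal}(1)=1$ and $\mathrm{Pal}(wa)=(\mathrm{Pal}(w)a)^{(+)}$ for $w\in A^*$, $a\in A$. For a language $L\subseteq A^*$ and $w\in A^*$ put $w^{-1}L=\{v\in A^*\mid wv\in L\}$. A nonempty residual of $L$ is called special if it can be written $w^{-1}L$ where $w=1$, or $w\in L$, or $w^{-1}L$ contains two words beginning with different letters. The minimal compact automaton $\mathcal A_c(L)$ of $L$ has as states the special residuals of $L$; its initial state is $L$; its terminal states are the residuals $w^{-1}L$ with $w\in L$; its edges are the triples $(w^{-1}L,\,v,\,(wv)^{-1}L)$ (from the first state to the third, labelled by the nonempty word $v$) between special residuals for which there is no factorization $v=v'v''$ with $v',v''$ nonempty such that $(wv')^{-1}L$ is a special residual. Let $L$ be the set of suffixes of $\mathrm{Pal}(u)$ and let $\mathcal S_c(u)=\mathcal A_c(L)$ be the minimal compact suffix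 automaton of $\mathrm{Pal}(u)$. **Theorem.** The map $x\mapsto \mathrm{Pal}(x)^{-1}L$ is a bijection from the set of prefixes of $u$ onto the set of states of $\mathcal S_c(u)$. Identifying states with prefixes of $u$ through this bijection, the initial state is $1$, all states are terminal, and the edges are exactly the following: for each factorization $u=xyaz$ with $x,y,z\in A^*$, $a\in A$ and $a$ not occurring in $y$, the word $\mathrm{Pal}(xy)$ is a prefix of $\mathrm{Pal}(xya)$ and there is an edge $x\to xya$ labelled $\mathrm{Pal}(xy)^{-1}\mathrm{Pal}(xya)$, i.e. labelled by the word $v$ such that $\mathrm{Pal}(xy)\,v=\mathrm{Pal}(xya)$. -/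

import Mathlib

namespace PalAutomaton

section Words

variable {A : Type*}

/-- A word is a palindrome if it equals its reversal. -/
def IsPalindrome (w : List A) : Prop := w.reverse = w

theorem exists_drop_isPalindrome (w : List A) : ∃ k, IsPalindrome (w.drop k) :=
  ⟨w.length, by simp [IsPalindrome]⟩

open Classical in
/-- The length of the shortest `y` such that `w = yz` with `z` a palindrome; thus
`w.drop (palIndex w)` is the longest palindromic suffix of `w`. -/
noncomputable def palIndex (w : List A) : ℕ := Nat.find (exists_drop_isPalindrome w)

/-- The palindromic closure `w⁽⁺⁾ = y z ỹ` of `w = y z`, where `z` is the longest palindromic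
suffix of `w`. By `palClosure_spec` it is the unique shortest palindrome with prefix `w`. -/
noncomputable def palClosure (w : List A) : List A :=
  w.take (palIndex w) ++ w.drop (palIndex w) ++ (w.take (palIndex w)).reverse

theorem palIndex_spec (w : List A) : IsPalindrome (w.drop (palIndex w)) := by
  classical
  unfold palIndex
  exact Nat.find_spec (exists_drop_isPalindrome w)

theorem palIndex_le (w : List A) {k : ℕ} (h : IsPalindrome (w.drop k)) : palIndex w ≤ k := by
  classical
  unfold palIndex
  exact Nat.find_min' (exists_drop_isPalindrome w) h

theorem palIndex_le_length (w : List A) : palIndex w ≤ w.length :=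
  palIndex_le w (by simp [IsPalindrome])

/-- `palClosure w` is a palindrome with prefix `w`, no palindrome with prefix `w` is shorter, and
it is the only one of its length. -/
theorem palClosure_spec (w : List A) :
    IsPalindrome (palClosure w) ∧ w <+: palClosure w ∧
      ∀ q : List A, IsPalindrome q → w <+: q →
        (palClosure w).length ≤ q.length ∧
          (q.length = (palClosure w).length → q = palClosure w) := by
  have hw : palClosure w = w ++ (w.take (palIndex w)).reverse := by simp [palClosure]
  have hk := palIndex_le_length w
  have hlen : (palClosure w).length = w.length + palIndex w := by
    rw [hw]; simp [hk]
  refine ⟨?_, ⟨_, hw.symm⟩, ?_⟩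
  · have := palIndex_spec w
    unfold IsPalindrome at this ⊢
    unfold palClosure
    simp only [List.reverse_append, List.reverse_reverse, this, List.append_assoc]
  · rintro q hq ⟨t, rfl⟩
    rw [hlen, List.length_append]
    rcases le_or_gt t.length w.length with ht | ht
    · have h1 : t.reverse ++ w.reverse = w ++ t := by
        rw [← List.reverse_append]; exact hq
      have h2 : t.reverse = w.take t.length := by
        have := congrArg (List.take t.length) h1
        simpa [List.take_append_of_le_length ht] using this
      have h3 : IsPalindrome (w.drop t.length) := by
        have h4 : w = t.reverse ++ w.drop t.length := by
          rw [h2, List.take_append_drop]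
        generalize w.drop t.length = z at h4
        subst h4
        simpa [IsPalindrome] using h1
      have h5 := palIndex_le w h3
      refine ⟨by omega, fun h => ?_⟩
      have h6 : t.length = palIndex w := by omega
      rw [hw, ← h6, ← h2, List.reverse_reverse]
    · exact ⟨by omega, fun h => by omega⟩

/-- The iterated palindromic closure: `Pal 1 = 1` and `Pal (w a) = (Pal(w) a)⁽⁺⁾`. -/
noncomputable def Pal (u : List A) : List A :=
  u.foldl (fun p a => palClosure (p ++ [a])) []

theorem Pal_nil : Pal ([] : List A) = [] := rfl

theorem Pal_concat (w : List A) (a : A) : Pal (w ++ [a]) = palClosure (Pal w ++ [a]) := by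
  simp [Pal]

/-- The set of suffixes of a word. -/
def suffixLanguage (w : List A) : Language A := {s | s <:+ w}

end Words

/-- A compact automaton over the alphabet `A` with set of states `Q`: edges are labelled by
nonempty words. -/
structure CompactAutomaton (A Q : Type*) where
  edges : Set (Q × List A × Q)
  initial : Set Q
  terminal : Set Q
  label_ne_nil : ∀ p v q, (p, v, q) ∈ edges → v ≠ []

section Minimal

variable {A : Type*}

/-- `R` is a special residual of `L`: it is nonempty and can be written `R = w⁻¹L` where
`w = 1`, or `w ∈ L`, or two words of `w⁻¹L` begin with different letters. Here `w⁻¹L` is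
`L.leftQuotient w = {v | w v ∈ L}`. -/
def IsSpecialResidual (L R : Language A) : Prop :=
  (∃ s, s ∈ R) ∧ ∃ w : List A, R = L.leftQuotient w ∧
    (w = [] ∨ w ∈ L ∨
      ∃ (a b : A) (s t : List A), a ≠ b ∧ a :: s ∈ L.leftQuotient w ∧ b :: t ∈ L.leftQuotient w)

/-- The minimal compact automaton of a language `L`. Its states are the special residuals of `L`,
the initial state is `L`, the terminal states are the `w⁻¹L` with `w ∈ L`, and the edges are
the `(w⁻¹L, v, (wv)⁻¹L)` with `v` nonempty such that there is no factorization `v = v'v''` with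
`v', v''` nonempty for which `(wv')⁻¹L` is a special residual. -/
def minimalCompactAutomaton (L : Language A) :
    CompactAutomaton A {R : Language A // IsSpecialResidual L R} where
  edges := {e | e.2.1 ≠ [] ∧ ∃ w : List A,
    e.1.1 = L.leftQuotient w ∧ e.2.2.1 = L.leftQuotient (w ++ e.2.1) ∧
      ¬ ∃ v' v'' : List A, e.2.1 = v' ++ v'' ∧ v' ≠ [] ∧ v'' ≠ [] ∧
        IsSpecialResidual L (L.leftQuotient (w ++ v'))}
  initial := {q | q.1 = L}
  terminal := {q | ∃ w ∈ L, q.1 = L.leftQuotient w}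
  label_ne_nil := fun _ _ _ h => h.1

/-- `S_c(u)`: the minimal compact automaton of the set of suffixes of `Pal(u)`. -/
noncomputable def compactSuffixAutomaton (u : List A) :
    CompactAutomaton A {R : Language A // IsSpecialResidual (suffixLanguage (Pal u)) R} :=
  minimalCompactAutomaton (suffixLanguage (Pal u))

end Minimal

end PalAutomaton

namespace PalAutomaton

/-! ### Palindromic prefixes of `Pal u` -/

section PalStructure

variable {A : Type*}

/-! Write L for the set of suffixes of P = Pal(u). The palindromic prefixes of P are exactly the
words Pal(x), x a prefix of u, and every left special factor of P is a prefix of P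
(`prefix_of_left_special`). Hence a factor that is not a prefix can be extended to the left,
uniquely and without changing its residual, until it becomes a prefix, and distinct prefixes have
distinct residuals. By reversal, right special factors are suffixes; so a special residual comes
from a word that is both prefix and suffix of P, hence a palindrome Pal(x). This gives the states.

For the edges, if a does not occur in y then Pal(x)a does not occur in Pal(xy)
(`mem_of_Pal_append_infix`), so Pal(x)a has the residual of the prefix Pal(xy)a. Reading on from
there meets no special residual before Pal(xya). Since a non-special residual has only one possible
next letter, an edge is determined by its source and first letter.

The combinatorial core is that Pal(wa) = y z ỹ, where the center z is not a factor of Pal(x) for any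
prefix x of w (`not_center_infix_Pal_of_prefix`); a factor of Pal(wa) thus lies in Pal(w) or
contains the central z. -/

theorem reverse_Pal (u : List A) : (Pal u).reverse = Pal u := by
  induction u using List.reverseRecOn with
  | nil => rfl
  | append_singleton w a _ =>
    rw [Pal_concat]
    exact (palClosure_spec _).1

theorem Pal_append_prefix (w : List A) (a : A) : Pal w ++ [a] <+: Pal (w ++ [a]) := by
  rw [Pal_concat]
  exact (palClosure_spec _).2.1

theorem Pal_prefix_Pal {x u : List A} (h : x <+: u) : Pal x <+: Pal u := by
  obtain ⟨t, rfl⟩ := h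
  induction t using List.reverseRecOn with
  | nil => simp
  | append_singleton t b ih =>
    rw [← List.append_assoc]
    exact ih.trans ((List.prefix_append _ _).trans (Pal_append_prefix _ b))

theorem Pal_append_prefix_Pal {x u : List A} {a : A} (h : x ++ [a] <+: u) :
    Pal x ++ [a] <+: Pal u :=
  (Pal_append_prefix x a).trans (Pal_prefix_Pal h)

theorem exists_concat_prefix {x t : List A} (h : x <+: t) (hne : x ≠ t) :
    ∃ b, x ++ [b] <+: t := by
  obtain ⟨r, rfl⟩ := h
  cases r with
  | nil => simp at hne
  | cons b r => exact ⟨b, r, by simp⟩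

theorem Pal_length_lt {x t : List A} (h : x <+: t) (hne : x ≠ t) :
    (Pal x).length < (Pal t).length := by
  obtain ⟨b, hb⟩ := exists_concat_prefix h hne
  have := (Pal_append_prefix_Pal hb).length_le
  simp at this
  omega

/-- Among prefixes of a word, `Pal` reflects the order by length. -/
theorem prefix_of_Pal_length_le {x t u : List A} (hx : x <+: u) (ht : t <+: u)
    (h : (Pal x).length ≤ (Pal t).length) : x <+: t := by
  rcases le_total x.length t.length with hl | hl
  · exact List.prefix_of_prefix_length_le hx ht hl
  · have h1 := List.prefix_of_prefix_length_le ht hx hl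
    by_cases he : t = x
    · rw [he]
    · have := Pal_length_lt h1 he
      omega

theorem eq_of_Pal_length_eq {x t u : List A} (hx : x <+: u) (ht : t <+: u)
    (h : (Pal x).length = (Pal t).length) : x = t := by
  by_contra hne
  have := Pal_length_lt (prefix_of_Pal_length_le hx ht h.le) hne
  omega

/-- The palindromic prefixes of `Pal u` are the words `Pal x` with `x` a prefix of `u`. -/
theorem exists_eq_Pal_of_palindrome_prefix {u q : List A} (hq : q <+: Pal u)
    (hp : IsPalindrome q) : ∃ x, x <+: u ∧ q = Pal x := by
  induction u using List.reverseRecOn with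
  | nil => exact ⟨[], List.prefix_rfl, by simpa [Pal_nil] using hq⟩
  | append_singleton w a ih =>
    have hw := Pal_append_prefix w a
    rcases Nat.lt_or_ge (Pal w).length q.length with hl | hl
    · have h1 : Pal w ++ [a] <+: q :=
        List.prefix_of_prefix_length_le hw hq (by simpa using hl)
      have h2 := (palClosure_spec (Pal w ++ [a])).2.2 q hp h1
      rw [← Pal_concat] at h2
      exact ⟨_, List.prefix_rfl, h2.2 (le_antisymm hq.length_le h2.1)⟩
    · obtain ⟨x, hx, rfl⟩ :=
        ih (List.prefix_of_prefix_length_le hq (Pal_prefix_Pal (List.prefix_append _ _)) hl)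
      exact ⟨x, hx.trans (List.prefix_append _ _), rfl⟩

theorem concat_prefix_of_Pal {t w : List A} {a : A} (ht : t <+: w)
    (h : Pal t ++ [a] <+: Pal w) : t ++ [a] <+: w := by
  have hne : t ≠ w := by
    rintro rfl
    have := h.length_le
    simp at this
  obtain ⟨b, hb⟩ := exists_concat_prefix ht hne
  have h1 := List.prefix_of_prefix_length_le h (Pal_append_prefix_Pal hb) (by simp)
  have h2 := h1.eq_of_length (by simp)
  have h3 : a = b := by simpa using h2
  rwa [h3]

/-! ### Centers of palindromic closures and special factors -/

theorem exists_last_occurrence {a : A} {w : List A} (h : a ∈ w) :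
    ∃ s t, w = s ++ a :: t ∧ a ∉ t := by
  obtain ⟨s, t, h1, h2⟩ := List.eq_append_cons_of_mem (List.mem_reverse.2 h)
  refine ⟨t.reverse, s.reverse, ?_, by simpa using h2⟩
  have := congrArg List.reverse h1
  simpa using this

/-- `z` is the letter `a` if `a` does not occur in `w`, and `a Pal(s) a` where `sa` is the longest
prefix of `w` ending with `a` otherwise. -/
def IsCenter (w : List A) (a : A) (z : List A) : Prop :=
  (a ∉ w ∧ z = [a]) ∨ ∃ s t, w = s ++ a :: t ∧ a ∉ t ∧ z = a :: (Pal s ++ [a])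

/-- A palindromic suffix of Pal(w)a of length at least two is a q a with q a palindrome; by reversal
qa is a prefix of Pal(w), so q = Pal(t) with ta a prefix of w. The longest one comes from the last
occurrence of a in w. -/
theorem exists_center (w : List A) (a : A) :
    ∃ y z, Pal w ++ [a] = y ++ z ∧ Pal (w ++ [a]) = y ++ z ++ y.reverse ∧ z.reverse = z ∧
      IsCenter w a z := by
  set k := palIndex (Pal w ++ [a]) with hk
  refine ⟨(Pal w ++ [a]).take k, (Pal w ++ [a]).drop k, by simp, by rw [Pal_concat]; rfl,
    palIndex_spec _, ?_⟩
  have hle : k ≤ (Pal w).length := palIndex_le _ (by simp [IsPalindrome])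
  have hdrop : (Pal w ++ [a]).drop k = (Pal w).drop k ++ [a] := List.drop_append_of_le_length hle
  have hpal := palIndex_spec (Pal w ++ [a])
  rw [← hk, hdrop, IsPalindrome] at hpal
  rw [hdrop]
  have htd := List.take_append_drop k (Pal w)
  have hlen : ((Pal w).drop k).length = (Pal w).length - k := by simp
  generalize (Pal w).drop k = z at *
  generalize (Pal w).take k = y at htd
  -- a longest palindromic suffix of length at least two is `a Pal(t) a`
  have key : z = [] ∨ ∃ t, t ++ [a] <+: w ∧ z = a :: Pal t := by
    cases z with
    | nil => exact Or.inl rfl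
    | cons b z =>
      right
      simp only [List.reverse_append, List.reverse_cons, List.reverse_nil, List.nil_append,
        List.cons_append, List.cons.injEq] at hpal
      obtain ⟨rfl, h0⟩ := hpal
      have hz : z.reverse = z := by simpa using h0
      have h1 : z ++ [a] <+: Pal w := by
        refine ⟨y.reverse, ?_⟩
        rw [← reverse_Pal w, ← htd]
        simp [hz]
      obtain ⟨t, ht, rfl⟩ := exists_eq_Pal_of_palindrome_prefix
        ((List.prefix_append _ _).trans h1) hz
      exact ⟨t, concat_prefix_of_Pal ht h1, rfl⟩
  by_cases ha : a ∈ w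
  · right
    obtain ⟨s, r, rfl, hr⟩ := exists_last_occurrence ha
    refine ⟨s, r, rfl, hr, ?_⟩
    have hs : Pal s ++ [a] <+: Pal (s ++ a :: r) := Pal_append_prefix_Pal ⟨r, by simp⟩
    obtain ⟨q, hq⟩ := hs
    have hq' : Pal (s ++ a :: r) = q.reverse ++ a :: Pal s := by
      rw [← reverse_Pal (s ++ a :: r), ← hq]
      simp [reverse_Pal]
    -- a Pal(s) a is itself a palindromic suffix, so the longest one is at least as long.
    have h2 : k ≤ q.length := by
      apply palIndex_le
      rw [hq']
      simp [IsPalindrome, reverse_Pal]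
    have h3 : (Pal (s ++ a :: r)).length = q.length + ((Pal s).length + 1) := by
      rw [hq']; simp
    rcases key with rfl | ⟨t, ht, rfl⟩
    · simp at hlen
      omega
    · simp only [List.length_cons] at hlen
      have ht' : t <+: s ++ a :: r := (List.prefix_append _ _).trans ht
      have hst : s <+: t := prefix_of_Pal_length_le (List.prefix_append _ _) ht' (by omega)
      obtain ⟨m, rfl⟩ := hst
      cases m with
      | nil => simp
      | cons b m =>
        exfalso
        rw [List.append_assoc, List.prefix_append_right_inj, List.cons_append,
          List.cons_prefix_cons] at ht
        exact hr (ht.2.subset (by simp))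
  · left
    refine ⟨ha, ?_⟩
    rcases key with rfl | ⟨t, ht, rfl⟩
    · rfl
    · exact absurd (ht.subset (by simp)) ha

theorem mem_of_mem_Pal {c : A} {u : List A} (h : c ∈ Pal u) : c ∈ u := by
  induction u using List.reverseRecOn with
  | nil => simp [Pal_nil] at h
  | append_singleton w a ih =>
    obtain ⟨y, z, h1, h2, -, -⟩ := exists_center w a
    have h3 : c ∈ Pal w ++ [a] := by
      rw [h1]
      rw [h2] at h
      simp only [List.mem_append, List.mem_reverse] at h ⊢
      tauto
    simp only [List.mem_append] at h3 ⊢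
    exact h3.imp_left ih

theorem center_append_reverse {p y z : List A} {a : A} (hp : p.reverse = p)
    (hz : z.reverse = z) (h : p ++ [a] = y ++ z) : z ++ y.reverse = a :: p := by
  have := congrArg List.reverse h
  simpa [hp, hz] using this.symm

/-- A factor of `y z ỹ`, where `yz = pa` with `p` and `z` palindromes, is a factor of `p` or
contains the central occurrence of `z`. -/
theorem infix_or_contains_center {p y z g f h : List A} {a : A} (hp : p.reverse = p)
    (hz : z.reverse = z) (hyz : p ++ [a] = y ++ z) (he : g ++ f ++ h = y ++ z ++ y.reverse) :
    f <:+: p ∨ ∃ f₁ f₂, f = f₁ ++ z ++ f₂ ∧ y = g ++ f₁ ∧ y.reverse = f₂ ++ h := by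
  have hrev := center_append_reverse hp hz hyz
  have hl := congrArg List.length he
  have hl' := congrArg List.length hyz
  simp only [List.length_append, List.length_reverse, List.length_singleton] at hl hl'
  rcases Nat.lt_or_ge p.length (g.length + f.length) with h1 | h1
  · rcases Nat.lt_or_ge y.length g.length with h2 | h2
    · left
      have h3 : f ++ h <:+ p := by
        refine List.suffix_of_suffix_length_le (l₃ := y ++ z ++ y.reverse)
          ⟨g, by rw [← he]; simp⟩ ⟨y ++ [a], by simp [hrev]⟩ ?_
        simp only [List.length_append]
        omega
      exact (List.prefix_append f h).isInfix.trans h3.isInfix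
    · right
      have h3 : g <+: y := List.prefix_of_prefix_length_le (l₃ := y ++ z ++ y.reverse)
        ⟨f ++ h, by rw [← he]; simp⟩ ⟨z ++ y.reverse, by simp⟩ h2
      obtain ⟨f₁, rfl⟩ := h3
      simp only [List.append_assoc, List.append_cancel_left_eq] at he
      simp only [List.length_append] at hl hl' h1 h2
      have h4 : f₁ ++ z <+: f := List.prefix_of_prefix_length_le (l₃ := f ++ h)
        ⟨(g ++ f₁).reverse, by rw [he]; simp⟩ ⟨h, rfl⟩ (by simp only [List.length_append]; omega)
      obtain ⟨f₂, rfl⟩ := h4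
      simp only [List.append_assoc, List.append_cancel_left_eq] at he
      exact ⟨f₁, f₂, rfl, rfl, he.symm⟩
  · left
    have h3 : g ++ f <+: p := List.prefix_of_prefix_length_le (l₃ := y ++ z ++ y.reverse)
      ⟨h, he⟩ ⟨[a] ++ y.reverse, by rw [← List.append_assoc, hyz]⟩ (by simpa using h1)
    exact (List.suffix_append g f).isInfix.trans h3.isInfix

theorem infix_of_eq_append_of_ne_nil {p z f₁ f₂ : List A} {b : A} (h : p ++ [b] = f₁ ++ z ++ f₂)
    (h₂ : f₂ ≠ []) : f₁ ++ z <+: p := by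
  obtain ⟨f, c, rfl⟩ : ∃ f c, f₂ = f ++ [c] := by
    rcases List.eq_nil_or_concat f₂ with h | ⟨f, c, h⟩
    · exact absurd h h₂
    · exact ⟨f, c, by simpa using h⟩
  rw [← List.append_assoc] at h
  exact ⟨f, ((List.append_inj_left' h rfl)).symm⟩

theorem infix_of_cons_eq_append {p z f₁ f₂ : List A} {b c : A}
    (h : b :: (p ++ [c]) = f₁ ++ z ++ f₂) (h₁ : f₁ ≠ []) (h₂ : f₂ ≠ []) : z <:+: p := by
  cases f₁ with
  | nil => exact absurd rfl h₁
  | cons d f₁ =>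
    simp only [List.cons_append, List.cons.injEq] at h
    exact (List.suffix_append f₁ z).isInfix.trans (infix_of_eq_append_of_ne_nil h.2 h₂).isInfix

/-- `hD` is the conclusion of `not_infix_Pal_of_notMem` for x, kept as a hypothesis so that this can
be used inside that lemma's induction. For z = c Pal(s) c, either Pal(x) is too short to contain z,
or sc is a prefix of x and c does not recur after it. -/
theorem not_center_infix_of_prefix {w x z : List A} {c : A} (hz : IsCenter w c z) (hx : x <+: w)
    (hD : ∀ s t, x = s ++ c :: t → c ∉ t → ¬ c :: (Pal s ++ [c]) <:+: Pal x) :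
    ¬ z <:+: Pal x := by
  intro hinf
  rcases hz with ⟨hc, rfl⟩ | ⟨s, t, hw, ht, rfl⟩
  · exact hc (hx.subset (mem_of_mem_Pal (hinf.subset (by simp))))
  · have hl := hinf.length_le
    simp only [List.length_cons, List.length_append, List.length_nil] at hl
    have hs : s <+: w := ⟨_, hw.symm⟩
    obtain ⟨m, rfl⟩ := prefix_of_Pal_length_le hs hx (by omega)
    cases m with
    | nil =>
      simp only [List.append_nil] at hl
      omega
    | cons b m =>
      rw [hw, List.prefix_append_right_inj, List.cons_prefix_cons] at hx
      obtain ⟨rfl, hm⟩ := hx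
      exact hD s m rfl (fun h => ht (hm.subset h)) hinf

theorem IsCenter.eq_cons {w z : List A} {c : A} (h : IsCenter w c z) : ∃ z', z = c :: z' := by
  rcases h with ⟨_, rfl⟩ | ⟨s, t, _, _, rfl⟩ <;> exact ⟨_, rfl⟩

theorem IsCenter.eq_concat {w z : List A} {c : A} (h : IsCenter w c z) : ∃ z', z = z' ++ [c] := by
  rcases h with ⟨_, rfl⟩ | ⟨s, t, _, _, rfl⟩
  · exact ⟨[], rfl⟩
  · exact ⟨c :: Pal s, rfl⟩

/-- Strong induction on the length of w, through the bound n. An occurrence created by the last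
closure would contain its center strictly inside, so the center would be a factor of Pal(s), which
induction excludes. -/
theorem not_infix_Pal_of_notMem (n : ℕ) : ∀ (w s t : List A) (a : A), w.length ≤ n →
    w = s ++ a :: t → a ∉ t → ¬ a :: (Pal s ++ [a]) <:+: Pal w := by
  induction n with
  | zero =>
    rintro w s t a hn rfl
    simp at hn
  | succ n ih =>
    intro w s t a hn hw ht hinf
    rcases List.eq_nil_or_concat t with rfl | ⟨t, c, rfl⟩
    · subst hw
      obtain ⟨y, z, h1, h2, h3, h4⟩ := exists_center s a
      obtain ⟨g, h, he⟩ := hinf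
      rw [h2] at he
      have hU : ¬ z <:+: Pal s := not_center_infix_of_prefix h4 List.prefix_rfl
        fun s' t' hs ht' => ih _ _ _ _ (by simpa using hn) hs ht'
      rcases infix_or_contains_center (reverse_Pal s) h3 h1 he with h5 | ⟨f₁, f₂, h5, h6, h7⟩
      · have := h5.length_le
        simp at this
      · have l1 := congrArg List.length h1
        have l5 := congrArg List.length h5
        have l6 := congrArg List.length h6
        have l7 := congrArg List.length h7
        simp only [List.length_cons, List.length_append, List.length_nil,
          List.length_reverse] at l1 l5 l6 l7
        -- Lengths give |f₁| + |f₂| = |y| + 1 while both are at most |y|, so neither is empty.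
        refine hU (infix_of_cons_eq_append h5 ?_ ?_)
        · rintro rfl
          simp only [List.length_nil] at l5
          omega
        · rintro rfl
          simp only [List.length_nil] at l5
          omega
    · have hw' : w = (s ++ a :: t) ++ [c] := by rw [hw]; simp
      subst hw'
      obtain ⟨y, z, h1, h2, h3, h4⟩ := exists_center (s ++ a :: t) c
      obtain ⟨g, h, he⟩ := hinf
      rw [h2] at he
      simp only [List.concat_eq_append, List.mem_append, List.mem_singleton, not_or] at ht
      simp only [List.length_append, List.length_cons, List.length_nil] at hn
      rcases infix_or_contains_center (reverse_Pal _) h3 h1 he with h5 | ⟨f₁, f₂, h5, -, -⟩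
      · exact ih _ s t a (by simp only [List.length_append, List.length_cons]; omega) rfl ht.1 h5
      · refine not_center_infix_of_prefix h4 (List.prefix_append s _)
          (fun s' t' hs ht' => ih _ _ _ _ (by omega) hs ht') (infix_of_cons_eq_append h5 ?_ ?_)
        · rintro rfl
          obtain ⟨z', rfl⟩ := h4.eq_cons
          simp only [List.nil_append, List.cons_append, List.cons.injEq] at h5
          exact ht.2 h5.1
        · rintro rfl
          obtain ⟨z', rfl⟩ := h4.eq_concat
          have h6 : (a :: Pal s) ++ [a] = (f₁ ++ z') ++ [c] := by simpa using h5
          have h7 := List.append_inj_right' h6 rfl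
          simp only [List.cons.injEq, and_true] at h7
          exact ht.2 h7

theorem not_center_infix_Pal_of_prefix {w x z : List A} {c : A} (hz : IsCenter w c z)
    (hx : x <+: w) : ¬ z <:+: Pal x :=
  not_center_infix_of_prefix hz hx fun s t h ht => not_infix_Pal_of_notMem _ _ s t c le_rfl h ht

/-- If `a` does not occur in `y` then `Pal(x)a` is not a factor of `Pal(xy)`. -/
theorem mem_of_Pal_append_infix {x y : List A} {a : A} (h : Pal x ++ [a] <:+: Pal (x ++ y)) :
    a ∈ y := by
  induction y using List.reverseRecOn with
  | nil =>
    have := h.length_le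
    simp at this
  | append_singleton y b ih =>
    by_contra ha
    simp only [List.mem_append, List.mem_singleton, not_or] at ha
    obtain ⟨y', z, h1, h2, h3, h4⟩ := exists_center (x ++ y) b
    obtain ⟨g, k, he⟩ := h
    rw [← List.append_assoc x, h2] at he
    rcases infix_or_contains_center (reverse_Pal _) h3 h1 he with h5 | ⟨f₁, f₂, h5, -, -⟩
    · exact ha.1 (ih h5)
    · have hne : f₂ ≠ [] := by
        rintro rfl
        obtain ⟨z', rfl⟩ := h4.eq_concat
        rw [List.append_nil, ← List.append_assoc] at h5
        have h7 := List.append_inj_right' h5 rfl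
        simp only [List.cons.injEq, and_true] at h7
        exact ha.2 h7
      exact not_center_infix_Pal_of_prefix h4 (List.prefix_append x y)
        ((List.suffix_append f₁ z).isInfix.trans (infix_of_eq_append_of_ne_nil h5 hne).isInfix)

/-- Left special factors of `Pal u` are prefixes of `Pal u`. -/
theorem prefix_of_left_special {u f : List A} {c d : A} (hcd : c ≠ d)
    (hc : c :: f <:+: Pal u) (hd : d :: f <:+: Pal u) : f <+: Pal u := by
  induction u using List.reverseRecOn with
  | nil => simp [Pal_nil] at hc
  | append_singleton w a ih =>
    obtain ⟨y, z, h1, h2, h3, h4⟩ := exists_center w a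
    have hU := not_center_infix_Pal_of_prefix h4 List.prefix_rfl
    have hrev := center_append_reverse (reverse_Pal w) h3 h1
    have key : ∀ {c d : A}, c ≠ d → c :: f <:+: Pal (w ++ [a]) → d :: f <:+: Pal (w ++ [a]) →
        c :: f <:+: Pal w ∨ f <+: Pal w := by
      rintro c d hcd ⟨g, h, he⟩ ⟨g', h', he'⟩
      rw [h2] at he he'
      refine (infix_or_contains_center (reverse_Pal w) h3 h1 he).imp_right ?_
      rintro ⟨f₁, f₂, h5, h6, h7⟩
      cases f₁ with
      | nil =>
        obtain ⟨z', rfl⟩ := h4.eq_cons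
        simp only [List.nil_append, List.cons_append, List.cons.injEq] at h5 hrev
        exact ⟨h, by rw [h5.2, ← hrev.2, h7]; simp⟩
      | cons b f₁ =>
        simp only [List.cons_append, List.cons.injEq] at h5
        obtain ⟨rfl, rfl⟩ := h5
        have he2 : (g' ++ d :: f₁) ++ z ++ (f₂ ++ h') = y ++ z ++ y.reverse := by
          rw [← he']; simp
        rcases infix_or_contains_center (reverse_Pal w) h3 h1 he2 with h8 | ⟨m₁, m₂, h8, h9, -⟩
        · exact absurd h8 hU
        · have l8 := congrArg List.length h8
          simp only [List.length_append] at l8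
          obtain rfl : m₁ = [] := List.eq_nil_of_length_eq_zero (by omega)
          rw [h6, List.append_nil] at h9
          have := List.append_inj_right' h9 (by simp)
          simp only [List.cons.injEq, and_true] at this
          exact absurd this hcd
    have hw : Pal w <+: Pal (w ++ [a]) := Pal_prefix_Pal (List.prefix_append _ _)
    rcases key hcd hc hd with h5 | h5
    · rcases key hcd.symm hd hc with h6 | h6
      · exact (ih h5 h6).trans hw
      · exact h6.trans hw
    · exact h5.trans hw

end PalStructure

/-! ### Residuals of the suffix language and the states -/

section Residuals

variable {A : Type*}

theorem mem_leftQuotient_suffixLanguage {p w v : List A} :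
    v ∈ (suffixLanguage p).leftQuotient w ↔ w ++ v <:+ p := Iff.rfl

theorem infix_of_append_suffix {p w v : List A} (h : w ++ v <:+ p) : w <:+: p :=
  (List.prefix_append w v).isInfix.trans h.isInfix

/-- Prefixes of a word are determined by their residuals. -/
theorem eq_of_leftQuotient_eq {p h k : List A} (hh : h <+: p) (hk : k <+: p)
    (he : (suffixLanguage p).leftQuotient h = (suffixLanguage p).leftQuotient k) : h = k := by
  have key : ∀ {h k : List A}, h <+: p →
      (suffixLanguage p).leftQuotient h = (suffixLanguage p).leftQuotient k →
      k.length ≤ h.length := by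
    rintro h k ⟨t, rfl⟩ he
    have : t ∈ (suffixLanguage (h ++ t)).leftQuotient k := by
      rw [← he]
      exact List.suffix_rfl
    have := (mem_leftQuotient_suffixLanguage.1 this).length_le
    simp only [List.length_append] at this
    omega
  exact (List.prefix_of_prefix_length_le hh hk (key hk he.symm)).eq_of_length
    (le_antisymm (key hk he.symm) (key hh he))

/-- Every factor of `Pal u` is a suffix of a prefix of `Pal u` with the same residual. -/
theorem exists_prefix_leftQuotient_eq {u w : List A} (hw : w <:+: Pal u) :
    ∃ h, h <+: Pal u ∧ w <:+ h ∧
      (suffixLanguage (Pal u)).leftQuotient h = (suffixLanguage (Pal u)).leftQuotient w := by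
  induction hn : (Pal u).length - w.length using Nat.strong_induction_on generalizing w with
  | _ n ih =>
    by_cases hp : w <+: Pal u
    · exact ⟨w, hp, List.suffix_rfl, rfl⟩
    have hext : ∀ v, w ++ v <:+ Pal u → ∃ c, c :: (w ++ v) <:+ Pal u := by
      rintro v ⟨g, hg⟩
      rcases List.eq_nil_or_concat g with rfl | ⟨g, c, rfl⟩
      · exact absurd ⟨v, by simpa using hg⟩ hp
      · exact ⟨c, g, by rw [← hg]; simp⟩
    obtain ⟨g, v, hg⟩ := hw
    obtain ⟨c, hc⟩ := hext v ⟨g, by rw [← hg]; simp⟩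
    have hcw : c :: w <:+: Pal u := infix_of_append_suffix (v := v) hc
    -- As w is not a prefix, it is not left special: c precedes each of its occurrences.
    have hres : (suffixLanguage (Pal u)).leftQuotient (c :: w) =
        (suffixLanguage (Pal u)).leftQuotient w := by
      ext v'
      simp only [mem_leftQuotient_suffixLanguage]
      constructor
      · exact fun h => (List.suffix_cons c _).trans h
      · intro h
        obtain ⟨d, hd⟩ := hext v' h
        by_cases hcd : c = d
        · rw [hcd]; exact hd
        · exact absurd (prefix_of_left_special hcd hcw (infix_of_append_suffix (v := v') hd)) hp
    have hl := hcw.length_le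
    simp only [List.length_cons] at hl
    obtain ⟨h, h1, h2, h3⟩ := ih ((Pal u).length - (c :: w).length)
      (by simp only [List.length_cons]; omega) hcw rfl
    exact ⟨h, h1, (List.suffix_cons c w).trans h2, h3.trans hres⟩

/-- Right special factors of `Pal u` are suffixes of `Pal u`. -/
theorem suffix_of_right_special {u f : List A} {c d : A} (hcd : c ≠ d)
    (hc : f ++ [c] <:+: Pal u) (hd : f ++ [d] <:+: Pal u) : f <:+ Pal u := by
  have key : ∀ {c : A}, f ++ [c] <:+: Pal u → c :: f.reverse <:+: Pal u := by
    intro c h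
    have := List.reverse_infix.2 h
    simpa [reverse_Pal] using this
  have := List.reverse_suffix.2 (prefix_of_left_special hcd (key hc) (key hd))
  simpa [reverse_Pal] using this

theorem isSpecialResidual_Pal {x u : List A} (hx : x <+: u) :
    IsSpecialResidual (suffixLanguage (Pal u)) ((suffixLanguage (Pal u)).leftQuotient (Pal x)) := by
  have hs : Pal x <:+ Pal u := by
    have := List.reverse_suffix.2 (Pal_prefix_Pal hx)
    simpa [reverse_Pal] using this
  refine ⟨⟨[], ?_⟩, Pal x, rfl, Or.inr (Or.inl hs)⟩
  rw [mem_leftQuotient_suffixLanguage, List.append_nil]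
  exact hs

theorem exists_Pal_of_isSpecialResidual {u : List A} {R : Language A}
    (hR : IsSpecialResidual (suffixLanguage (Pal u)) R) :
    ∃ x, x <+: u ∧ (suffixLanguage (Pal u)).leftQuotient (Pal x) = R := by
  obtain ⟨-, w, rfl, hw⟩ := hR
  have hs : w <:+ Pal u := by
    rcases hw with rfl | hw | ⟨a, b, s, t, hab, ha, hb⟩
    · exact List.nil_suffix
    · exact hw
    · rw [mem_leftQuotient_suffixLanguage, List.append_cons] at ha hb
      exact suffix_of_right_special hab (infix_of_append_suffix ha) (infix_of_append_suffix hb)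
  obtain ⟨h, h1, -, h3⟩ := exists_prefix_leftQuotient_eq hs.isInfix
  have h4 : h <:+ Pal u := by
    have : [] ∈ (suffixLanguage (Pal u)).leftQuotient h := by
      rw [h3, mem_leftQuotient_suffixLanguage, List.append_nil]
      exact hs
    rwa [mem_leftQuotient_suffixLanguage, List.append_nil] at this
  have h5 : IsPalindrome h := by
    have h6 := List.reverse_suffix.2 h1
    rw [reverse_Pal] at h6
    exact (List.suffix_of_suffix_length_le h6 h4 (by simp)).eq_of_length (by simp)
  obtain ⟨x, hx, rfl⟩ := exists_eq_Pal_of_palindrome_prefix h1 h5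
  exact ⟨x, hx, h3⟩

/-- The states of `S_c(u)` correspond to the prefixes of `u`. -/
noncomputable def stateEquiv (u : List A) :
    {x : List A // x <+: u} ≃ {R : Language A // IsSpecialResidual (suffixLanguage (Pal u)) R} :=
  Equiv.ofBijective
    (fun x => ⟨(suffixLanguage (Pal u)).leftQuotient (Pal x.1), isSpecialResidual_Pal x.2⟩) <| by
    constructor
    · rintro ⟨x, hx⟩ ⟨t, ht⟩ h
      have h1 := eq_of_leftQuotient_eq (Pal_prefix_Pal hx) (Pal_prefix_Pal ht)
        (congrArg Subtype.val h)
      exact Subtype.ext (eq_of_Pal_length_eq hx ht (congrArg List.length h1))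
    · rintro ⟨R, hR⟩
      obtain ⟨x, hx, h⟩ := exists_Pal_of_isSpecialResidual hR
      exact ⟨⟨x, hx⟩, Subtype.ext h⟩

theorem stateEquiv_coe (u : List A) (x : {x : List A // x <+: u}) :
    (stateEquiv u x : Language A) = (suffixLanguage (Pal u)).leftQuotient (Pal x.1) := rfl

theorem leftQuotient_append_congr {L : Language A} {w w' : List A}
    (h : L.leftQuotient w = L.leftQuotient w') (v : List A) :
    L.leftQuotient (w ++ v) = L.leftQuotient (w' ++ v) := by
  rw [Language.leftQuotient_append, Language.leftQuotient_append, h]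

/-- If `a` does not occur in `y`, then `Pal(x)a` and `Pal(xy)a` have the same residual. -/
theorem leftQuotient_Pal_append {u x y : List A} {a : A} (hu : x ++ y ++ [a] <+: u)
    (ha : a ∉ y) :
    (suffixLanguage (Pal u)).leftQuotient (Pal x ++ [a]) =
      (suffixLanguage (Pal u)).leftQuotient (Pal (x ++ y) ++ [a]) := by
  have hP := Pal_append_prefix_Pal hu
  have hs : Pal x <:+ Pal (x ++ y) := by
    have := List.reverse_suffix.2 (Pal_prefix_Pal (List.prefix_append x y))
    simpa [reverse_Pal] using this
  have hs' : Pal x ++ [a] <:+ Pal (x ++ y) ++ [a] := by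
    obtain ⟨g, hg⟩ := hs
    exact ⟨g, by rw [← hg]; simp⟩
  obtain ⟨h, h1, h2, h3⟩ := exists_prefix_leftQuotient_eq (hs'.isInfix.trans hP.isInfix)
  -- A shorter h would be a prefix of Pal(xy) ending with Pal(x)a, impossible since a is not in y.
  -- The opposite bound comes from the completion t of Pal(xy)a to Pal(u), which lies in the
  -- residual of h.
  have hle : (Pal (x ++ y) ++ [a]).length ≤ h.length := by
    by_contra hlt
    simp only [List.length_append, List.length_singleton, not_le] at hlt
    have h4 : h <+: Pal (x ++ y) :=
      List.prefix_of_prefix_length_le h1 ((List.prefix_append _ _).trans hP) (by omega)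
    exact ha (mem_of_Pal_append_infix (h2.isInfix.trans h4.isInfix))
  obtain ⟨t, ht⟩ := hP
  have h5 : t ∈ (suffixLanguage (Pal u)).leftQuotient h := by
    rw [h3, mem_leftQuotient_suffixLanguage, ← ht]
    obtain ⟨g, hg⟩ := hs'
    exact ⟨g, by rw [← hg]; simp⟩
  have h6 := (mem_leftQuotient_suffixLanguage.1 h5).length_le
  have h7 := congrArg List.length ht
  rw [List.length_append] at h6 h7
  have h8 : Pal (x ++ y) ++ [a] = h :=
    (List.prefix_of_prefix_length_le ⟨t, ht⟩ h1 hle).eq_of_length (by omega)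
  rw [← h3, h8]

/-! ### Edges -/

/-- `v` leads from the state `w⁻¹L` to a special residual, passing through no other one. -/
def IsEdgeLabel (L : Language A) (w v : List A) : Prop :=
  v ≠ [] ∧ IsSpecialResidual L (L.leftQuotient (w ++ v)) ∧
    ∀ v' v'', v = v' ++ v'' → v' ≠ [] → v'' ≠ [] →
      ¬ IsSpecialResidual L (L.leftQuotient (w ++ v'))

/-- Frees the edge condition from the choice of a word representing the source. -/
theorem mem_edges_iff {L : Language A} {p q : {R : Language A // IsSpecialResidual L R}}
    {v w : List A} (hp : p.1 = L.leftQuotient w) :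
    (p, v, q) ∈ (minimalCompactAutomaton L).edges ↔
      q.1 = L.leftQuotient (w ++ v) ∧ IsEdgeLabel L w v := by
  constructor
  · rintro ⟨hv, w', h1, h2, h3⟩
    have h4 := hp.symm.trans h1
    have h5 : q.1 = L.leftQuotient (w ++ v) := h2.trans (leftQuotient_append_congr h4 v).symm
    refine ⟨h5, hv, h5 ▸ q.2, fun v' v'' e n' n'' hs => h3 ⟨v', v'', e, n', n'', ?_⟩⟩
    rwa [← leftQuotient_append_congr h4 v']
  · rintro ⟨h1, h2, -, h3⟩
    refine ⟨h2, w, hp, h1, ?_⟩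
    rintro ⟨v', v'', e, n', n'', hs⟩
    exact h3 v' v'' e n' n'' hs

/-- From a given state there is at most one edge label with a given first letter. -/
theorem IsEdgeLabel.eq_of_cons {L : Language A} {w v₁ v₂ : List A} {a : A}
    (h₁ : IsEdgeLabel L w (a :: v₁)) (h₂ : IsEdgeLabel L w (a :: v₂)) : v₁ = v₂ := by
  obtain ⟨s₁, hs₁⟩ := h₁.2.1.1
  obtain ⟨s₂, hs₂⟩ := h₂.2.1.1
  -- While both labels continue past the common prefix m, the residual after m is not special, so
  -- the next letters agree.
  have key : ∀ m r₁ r₂ : List A, m ≠ [] → a :: v₁ = m ++ r₁ → a :: v₂ = m ++ r₂ → r₁ = r₂ := by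
    intro m r₁
    induction r₁ generalizing m with
    | nil =>
      intro r₂ hm e₁ e₂
      by_contra hne
      refine h₂.2.2 m r₂ e₂ hm (Ne.symm hne) ?_
      have := h₁.2.1
      rwa [e₁, List.append_nil] at this
    | cons b r₁ ih =>
      intro r₂ hm e₁ e₂
      have hns : ¬ IsSpecialResidual L (L.leftQuotient (w ++ m)) :=
        h₁.2.2 m _ e₁ hm (by simp)
      cases r₂ with
      | nil =>
        have := h₂.2.1
        rw [e₂, List.append_nil] at this
        exact absurd this hns
      | cons c r₂ =>
        have hb : b :: (r₁ ++ s₁) ∈ L.leftQuotient (w ++ m) := by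
          rw [e₁] at hs₁
          simpa [Language.mem_leftQuotient] using hs₁
        have hc : c :: (r₂ ++ s₂) ∈ L.leftQuotient (w ++ m) := by
          rw [e₂] at hs₂
          simpa [Language.mem_leftQuotient] using hs₂
        have hbc : b = c := by
          by_contra hbc
          exact hns ⟨⟨_, hb⟩, w ++ m, rfl, Or.inr (Or.inr ⟨b, c, _, _, hbc, hb, hc⟩)⟩
        subst hbc
        rw [ih (m ++ [b]) r₂ (by simp) (by simpa using e₁) (by simpa using e₂)]
  exact key [a] v₁ v₂ (by simp) rfl rfl

/-- After its first letter the label follows prefixes of P strictly longer than Pal(xy). A special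
residual before Pal(xya) would give some Pal(t) of length strictly between those of Pal(xy) and
Pal(xya). -/
theorem exists_edgeLabel {u x y : List A} {a : A} (hu : x ++ y ++ [a] <+: u) (ha : a ∉ y) :
    ∃ v, Pal (x ++ y) ++ a :: v = Pal (x ++ y ++ [a]) ∧
      (suffixLanguage (Pal u)).leftQuotient (Pal (x ++ y ++ [a])) =
        (suffixLanguage (Pal u)).leftQuotient (Pal x ++ a :: v) ∧
      IsEdgeLabel (suffixLanguage (Pal u)) (Pal x) (a :: v) := by
  obtain ⟨v, hv⟩ := Pal_append_prefix (x ++ y) a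
  have hv' : Pal (x ++ y) ++ a :: v = Pal (x ++ y ++ [a]) := by rw [← hv]; simp
  have hres : ∀ r, (suffixLanguage (Pal u)).leftQuotient (Pal x ++ a :: r) =
      (suffixLanguage (Pal u)).leftQuotient (Pal (x ++ y) ++ a :: r) := by
    intro r
    have := leftQuotient_append_congr (leftQuotient_Pal_append hu ha) r
    simpa using this
  have hxy : x ++ y <+: u := (List.prefix_append _ _).trans hu
  refine ⟨v, hv', by rw [hres, hv'], by simp, ?_, ?_⟩
  · rw [hres, hv']
    exact isSpecialResidual_Pal hu
  · intro v' v'' e n' n'' hs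
    cases v' with
    | nil => exact n' rfl
    | cons b r =>
      simp only [List.cons_append, List.cons.injEq] at e
      obtain ⟨rfl, rfl⟩ := e
      rw [hres] at hs
      obtain ⟨t, ht, h1⟩ := exists_Pal_of_isSpecialResidual hs
      have h2 : Pal (x ++ y) ++ a :: r <+: Pal (x ++ y ++ [a]) :=
        ⟨v'', by rw [← hv']; simp⟩
      have h3 := eq_of_leftQuotient_eq (Pal_prefix_Pal ht) (h2.trans (Pal_prefix_Pal hu)) h1
      have l3 := congrArg List.length h3
      have l4 := congrArg List.length hv'
      have l5 := List.length_pos_iff.2 n''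
      simp only [List.length_append, List.length_cons] at l3 l4
      have h4 : t <+: x ++ y ++ [a] := prefix_of_Pal_length_le ht hu (by omega)
      rcases List.prefix_concat_iff.1 h4 with rfl | h5
      · omega
      · have := (Pal_prefix_Pal h5).length_le
        omega

end Residuals

end PalAutomaton

open PalAutomaton in
/-- The states of `S_c(u)` are identified with the prefixes of `u` by the bijection `e`, which
maps a prefix `x` of `u` to the residual `Pal(x)⁻¹L`, with `L` the set of suffixes of `Pal(u)`. -/
theorem mainTheorem4 {A : Type*} (u : List A) :
    ∃ e : {x : List A // x <+: u} ≃
        {R : Language A // IsSpecialResidual (suffixLanguage (Pal u)) R},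
      (∀ x, (e x : Language A) = (suffixLanguage (Pal u)).leftQuotient (Pal (x : List A))) ∧
      (compactSuffixAutomaton u).initial = {e ⟨[], List.nil_prefix⟩} ∧
      (compactSuffixAutomaton u).terminal = Set.univ ∧
      -- each factorization `u = xyaz` with `y` free of `a` gives an edge `x → xya`
      (∀ (x y z : List A) (a : A) (h : u = x ++ y ++ [a] ++ z), a ∉ y →
        ∃ v : List A, Pal (x ++ y) ++ v = Pal (x ++ y ++ [a]) ∧
          (e ⟨x, ⟨y ++ [a] ++ z, by simp [h]⟩⟩, v, e ⟨x ++ y ++ [a], ⟨z, h.symm⟩⟩) ∈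
            (compactSuffixAutomaton u).edges) ∧
      -- and there are no other edges
      (∀ (p q : {x : List A // x <+: u}) (v : List A),
        (e p, v, e q) ∈ (compactSuffixAutomaton u).edges →
        ∃ (y z : List A) (a : A), u = (p : List A) ++ y ++ [a] ++ z ∧ a ∉ y ∧
          (q : List A) = (p : List A) ++ y ++ [a] ∧
          Pal ((p : List A) ++ y) ++ v = Pal ((p : List A) ++ y ++ [a])) := by
  have hnil : (suffixLanguage (Pal u)).leftQuotient (Pal ([] : List A)) = suffixLanguage (Pal u) :=
    Language.leftQuotient_nil _
  refine ⟨stateEquiv u, stateEquiv_coe u, ?_, ?_, ?_, ?_⟩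
  · ext q
    exact ⟨fun h => Subtype.ext (h.trans hnil.symm), fun h => h ▸ hnil⟩
  · refine Set.eq_univ_of_forall fun q => ?_
    obtain ⟨x, hx, h⟩ := exists_Pal_of_isSpecialResidual q.2
    refine ⟨Pal x, ?_, h.symm⟩
    have := List.reverse_suffix.2 (Pal_prefix_Pal hx)
    rwa [reverse_Pal, reverse_Pal] at this
  · intro x y z a h ha
    obtain ⟨v, h1, h2, h3⟩ := exists_edgeLabel (u := u) ⟨z, h.symm⟩ ha
    exact ⟨a :: v, h1, (mem_edges_iff (stateEquiv_coe u _)).2 ⟨h2, h3⟩⟩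
  · rintro ⟨p, r, rfl⟩ q v hv
    obtain ⟨h1, h2⟩ := (mem_edges_iff (stateEquiv_coe _ _)).1 hv
    cases v with
    | nil => exact absurd rfl h2.1
    | cons a v =>
      obtain ⟨s, hs⟩ := h2.2.1.1
      rw [mem_leftQuotient_suffixLanguage, List.append_assoc, List.cons_append,
        List.append_cons] at hs
      -- Pal(p)a is a factor of Pal(u), so a occurs in u after p; y stops before its first
      -- occurrence there.
      obtain ⟨y, z, rfl, ha⟩ :=
        List.eq_append_cons_of_mem (mem_of_Pal_append_infix (infix_of_append_suffix hs))
      have hu : p ++ y ++ [a] <+: p ++ (y ++ a :: z) := ⟨z, by simp⟩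
      obtain ⟨v', h3, h4, h5⟩ := exists_edgeLabel hu ha
      obtain rfl := h2.eq_of_cons h5
      refine ⟨y, z, a, by simp, ha, ?_, h3⟩
      have h6 : stateEquiv _ q = stateEquiv _ ⟨p ++ y ++ [a], hu⟩ :=
        Subtype.ext (h1.trans h4.symm)
      exact congrArg Subtype.val ((stateEquiv _).injective h6)
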